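/- For a group $G$ with a finite generating set $S$ and real $r\ge 1$, let $B_{G,S}(r)$ be the set of products $s_1^{\pm1}\cdots s_k^{\pm1}$ with $s_i\in S$ and $k\le r$. If $G$ is residually finite, put $D_G(g)=\min\{[G:N] : N\lhd G,\ g\notin N\}$ for $g\neq e$ and $\mathrm{RF}_{G,S}(r)=\max\{D_G(g) : e\ne g\in B_{G,S}(r)\}$. For functions $f,g$ on $[1,\infty)$ write $f\preceq g$ if there is $C>0$ with $f(r)\le C\,g(Cr)$ for all $r\ge\max\{1,1/C\}$. Here $\log$ is the natural logarithm. (1) Let $m\ge 1$, let $M\in \mathrm{GL}(m,\mathbb Z)$ be a matrix none of whose complex eigenvalues is a root of unity, and let $G=\mathbb Z^m\rtimes_\varphi\mathbb Z$ with $\varphi(1)=M$. Then $G$ is finitely generated and residually finite, and $r\log(r)\preceq \mathrm{RF}_{G,S}$ for every finite generating set $S$ of $G$. (2) Let $n\in\mathbb Z$ with $|n|>1$, and let $G=\mathrm{BS}(1,n)=\langle x,y\mid y^{-1}xy=x^n\rangle$. Then $G$ is finitely generated and residually finite, and $r\log(r)\preceq \mathrm{RF}_{G,S}$ for every finite generating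 set $S$ of $G$. -/

import Mathlib

open scoped Matrix

/-- The ball of radius `r` around the identity for the word metric given by `S`: all products
`s₁^{±1} ⋯ s_k^{±1}` with `s_i ∈ S` and `k ≤ r`. -/
def wordBall {G : Type*} [Group G] (S : Finset G) (r : ℝ) : Set G :=
  {g | ∃ l : List G, (∀ s ∈ l, s ∈ S ∨ s⁻¹ ∈ S) ∧ (l.length : ℝ) ≤ r ∧ l.prod = g}

/-- The divisibility function `D_G(g)`: the least index of a finite-index normal subgroup that
does not contain `g`. (For `g` lying in every such subgroup the value is `0`; this occurs for no
`g ≠ 1` in a residually finite group.) -/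
noncomputable def divisibility {G : Type*} [Group G] (g : G) : ℕ :=
  sInf {k : ℕ | ∃ N : Subgroup G, N.Normal ∧ N.FiniteIndex ∧ g ∉ N ∧ N.index = k}

/-- The residual finiteness growth `RF_{G,S}(r)`: the maximum of `D_G(g)` over the nontrivial
elements `g` of the ball of radius `r`. -/
noncomputable def RF {G : Type*} [Group G] (S : Finset G) (r : ℝ) : ℕ :=
  sSup {d : ℕ | ∃ g ∈ wordBall S r, g ≠ 1 ∧ divisibility g = d}

/-- The comparison `f ≼ g` of growth functions on `[1, ∞)`. -/
def GrowthLE (f g : ℝ → ℝ) : Prop :=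
  ∃ C : ℝ, 0 < C ∧ ∀ r : ℝ, max 1 (1 / C) ≤ r → f r ≤ C * g (C * r)

/-- Word balls are finite, so the supremum in `RF` is over a finite set. -/
theorem finite_wordBall {G : Type*} [Group G] (S : Finset G) (r : ℝ) :
    (wordBall S r).Finite := by
  classical
  let T : Set G := (S : Set G) ∪ (S : Set G)⁻¹
  have hT : T.Finite := S.finite_toSet.union S.finite_toSet.inv
  have : Finite T := hT
  refine ((List.finite_length_le T ⌊r⌋₊).image
    (fun l => (l.map (Subtype.val : T → G)).prod)).subset ?_
  rintro g ⟨l, hl, hr, rfl⟩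
  have hl' : ∀ s ∈ l, s ∈ T := fun s hs => hl s hs
  refine ⟨l.attach.map (fun s => ⟨s.1, hl' s.1 s.2⟩), ?_, ?_⟩
  · simpa using Nat.le_floor hr
  · simp only [List.map_map]
    congr 1
    exact l.attach_map_subtype_val

theorem divisibility_le_RF {G : Type*} [Group G] (S : Finset G) (r : ℝ) {g : G}
    (hg : g ∈ wordBall S r) (h1 : g ≠ 1) : divisibility g ≤ RF S r := by
  refine le_csSup (((finite_wordBall S r).image divisibility).subset ?_).bddAbove
    ⟨g, hg, h1, rfl⟩
  rintro d ⟨g, hg, -, rfl⟩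
  exact ⟨g, hg, rfl⟩

/-- The automorphism `v ↦ M v` of `ℤ^m` for `M ∈ GL(m, ℤ)`. -/
def matrixAut {m : ℕ} (M : GL (Fin m) ℤ) : MulAut (Multiplicative (Fin m → ℤ)) :=
  AddEquiv.toMultiplicative
    { toFun := fun v => (M : Matrix (Fin m) (Fin m) ℤ) *ᵥ v
      invFun := fun v => ((M⁻¹ : GL (Fin m) ℤ) : Matrix (Fin m) (Fin m) ℤ) *ᵥ v
      left_inv := fun v => by
        beta_reduce
        rw [Matrix.mulVec_mulVec, ← Units.val_mul, inv_mul_cancel, Units.val_one,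
          Matrix.one_mulVec]
      right_inv := fun v => by
        beta_reduce
        rw [Matrix.mulVec_mulVec, ← Units.val_mul, mul_inv_cancel, Units.val_one,
          Matrix.one_mulVec]
      map_add' := fun v w => Matrix.mulVec_add _ v w }

/-- The homomorphism `φ : ℤ → Aut(ℤ^m)` with `φ(1) = M`. -/
def matrixAction {m : ℕ} (M : GL (Fin m) ℤ) :
    Multiplicative ℤ →* MulAut (Multiplicative (Fin m → ℤ)) :=
  zpowersHom _ (matrixAut M)

theorem matrixAction_one {m : ℕ} (M : GL (Fin m) ℤ) (v : Fin m → ℤ) :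
    matrixAction M (Multiplicative.ofAdd 1) (Multiplicative.ofAdd v) =
      Multiplicative.ofAdd ((M : Matrix (Fin m) (Fin m) ℤ) *ᵥ v) := by
  simp [matrixAction, matrixAut]

/-- The group `ℤ^m ⋊_M ℤ`. -/
abbrev MatrixSemidirect {m : ℕ} (M : GL (Fin m) ℤ) : Type :=
  Multiplicative (Fin m → ℤ) ⋊[matrixAction M] Multiplicative ℤ

/-- The complex number `μ` is an eigenvalue of the integer matrix `M`. -/
def IsComplexEigenvalue {m : ℕ} (M : Matrix (Fin m) (Fin m) ℤ) (μ : ℂ) : Prop :=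
  Module.End.HasEigenvalue (Matrix.toLin' (M.map (Int.cast : ℤ → ℂ))) μ

/-- The Baumslag–Solitar group `BS(1,n) = ⟨x, y ∣ y⁻¹ x y = x^n⟩`, with generators
`x = of 0` and `y = of 1`. -/
abbrev BaumslagSolitar (n : ℤ) : Type :=
  PresentedGroup ({(FreeGroup.of 1)⁻¹ * FreeGroup.of 0 * FreeGroup.of 1 *
    (FreeGroup.of 0 ^ n)⁻¹} : Set (FreeGroup (Fin 2)))

/-! Both groups have an abelian normal subgroup `A`: `ℤ^m`, or the kernel of the height map of
`BS(1,n)`. For `N` normal of finite index put `q = [A : A ∩ N]`, so that `[G : N] = q [G : AN]`.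
Some `t ^ k` with `0 < k ≤ [G : AN]` lies in `AN`, hence centralises `A` modulo `N`. Since `t ^ k`
acts far from trivially, `A / (A ∩ N)` has exponent dividing some `D ≤ B ^ k`; thus `q ≤ B ^ (k m)`,
and `q log q ≤ m log B [G : N]` (`relIndex_mul_log_le_index`).

It remains to find, for each `L`, a nontrivial element of length `O(L)` lying in every `N` with `q <
L`. Any `lcm(1, …, L)`-th power from `A` lies in all of these. By Chebyshev the lcm is only
exponential in `L`, whereas a contracting conjugation yields exponentially many elements of `A` of
length `O(L)`, told apart as digit expansions (`conjWord_injective`). By pigeonhole two of them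
differ by such a power (`growthLE_RF`).

For `ℤ^m ⋊ ℤ`, Kronecker's theorem supplies an eigenvalue outside the closed unit disc, and `D =
|det (M ^ k - 1)|`. For `BS(1,n)` the expanding factor is `n`, and `D = |n ^ k - 1|`. -/

theorem one_mem_wordBall {G : Type*} [Group G] (S : Finset G) : (1 : G) ∈ wordBall S 0 :=
  ⟨[], by simp, by simp, by simp⟩

theorem mul_mem_wordBall {G : Type*} [Group G] {S : Finset G} {r s : ℝ} {g h : G}
    (hg : g ∈ wordBall S r) (hh : h ∈ wordBall S s) : g * h ∈ wordBall S (r + s) := by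
  obtain ⟨l, hl, hlr, rfl⟩ := hg
  obtain ⟨l', hl', hlr', rfl⟩ := hh
  refine ⟨l ++ l', ?_, ?_, by simp⟩
  · intro x hx
    rcases List.mem_append.1 hx with h | h
    exacts [hl x h, hl' x h]
  · push_cast [List.length_append]
    exact add_le_add hlr hlr'

theorem inv_mem_wordBall {G : Type*} [Group G] {S : Finset G} {r : ℝ} {g : G}
    (hg : g ∈ wordBall S r) : g⁻¹ ∈ wordBall S r := by
  obtain ⟨l, hl, hlr, rfl⟩ := hg
  refine ⟨(l.map (·⁻¹)).reverse, ?_, by simpa using hlr, by rw [List.prod_inv_reverse]⟩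
  intro x hx
  simp only [List.mem_reverse, List.mem_map] at hx
  obtain ⟨y, hy, rfl⟩ := hx
  simpa [or_comm] using hl y hy

theorem wordBall_mono {G : Type*} [Group G] {S : Finset G} {r s : ℝ} (hrs : r ≤ s) :
    wordBall S r ⊆ wordBall S s :=
  fun _ ⟨l, hl, hr, hg⟩ => ⟨l, hl, hr.trans hrs, hg⟩

theorem pow_mem_wordBall {G : Type*} [Group G] {S : Finset G} {r : ℝ} {g : G}
    (hg : g ∈ wordBall S r) (n : ℕ) : g ^ n ∈ wordBall S (n * r) := by
  induction n with
  | zero => simpa using one_mem_wordBall S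
  | succ n ih =>
    rw [pow_succ]
    convert mul_mem_wordBall ih hg using 1
    push_cast
    ring_nf

theorem exists_mem_wordBall {G : Type*} [Group G] {S : Finset G}
    (hS : Subgroup.closure (S : Set G) = ⊤) (g : G) : ∃ r : ℝ, g ∈ wordBall S r := by
  have hg : g ∈ Subgroup.closure (S : Set G) := by simp [hS]
  induction hg using Subgroup.closure_induction with
  | mem x hx => exact ⟨1, [x], by simpa using Or.inl hx, by simp, by simp⟩
  | one => exact ⟨0, one_mem_wordBall S⟩
  | mul x y _ _ hx hy =>
    obtain ⟨r, hr⟩ := hx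
    obtain ⟨s, hs⟩ := hy
    exact ⟨r + s, mul_mem_wordBall hr hs⟩
  | inv x _ hx =>
    obtain ⟨r, hr⟩ := hx
    exact ⟨r, inv_mem_wordBall hr⟩

/-! ### Many short elements of `A`: digit expansions -/

/-- The word `a^{ε₀} u a^{ε₁} u ⋯ a^{ε_{n-1}} u u^{-n}`, which equals the product of the conjugates
`u^i a^{ε_i} u^{-i}`. -/
def conjWord {G : Type*} [Group G] (a u : G) : List Bool → G
  | [] => 1
  | e :: l => (if e then a else 1) * (u * conjWord a u l * u⁻¹)

theorem conjWord_mem {G : Type*} [Group G] {A : Subgroup G} [A.Normal] {a : G} (ha : a ∈ A) (u : G)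
    (l : List Bool) : conjWord a u l ∈ A := by
  induction l with
  | nil => exact A.one_mem
  | cons e l ih =>
    refine A.mul_mem ?_ (Subgroup.Normal.conj_mem inferInstance _ ih u)
    split_ifs
    exacts [ha, A.one_mem]

/-- The conjugating powers of `u` telescope, so each digit costs one `a` and one `u`; the length is
linear rather than quadratic in the number of digits. -/
theorem conjWord_mul_pow_mem_wordBall {G : Type*} [Group G] {S : Finset G} {r : ℝ} (hr : 0 ≤ r)
    {a u : G} (ha : a ∈ wordBall S r) (hu : u ∈ wordBall S r) (l : List Bool) :
    conjWord a u l * u ^ l.length ∈ wordBall S (l.length * (2 * r)) := by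
  induction l with
  | nil => simpa [conjWord] using one_mem_wordBall S
  | cons e l ih =>
    have he : (if e then a else 1) ∈ wordBall S r := by
      split_ifs
      exacts [ha, wordBall_mono hr (one_mem_wordBall S)]
    have h := mul_mem_wordBall he (mul_mem_wordBall hu ih)
    convert h using 1
    · push_cast [List.length_cons]
      ring_nf
    · simp only [conjWord, List.length_cons, pow_succ']
      group

theorem conjWord_mem_wordBall {G : Type*} [Group G] {S : Finset G} {r : ℝ} (hr : 0 ≤ r)
    {a u : G} (ha : a ∈ wordBall S r) (hu : u ∈ wordBall S r) (l : List Bool) :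
    conjWord a u l ∈ wordBall S (l.length * (3 * r)) := by
  have h := mul_mem_wordBall (conjWord_mul_pow_mem_wordBall hr ha hu l)
    (inv_mem_wordBall (pow_mem_wordBall hu l.length))
  convert h using 1
  · ring_nf
  · group

/-- If `f` is additive on `A` and conjugation by `u` scales `f` by a factor of modulus at most
`1/3`, then the words `conjWord a u l` over lists of equal length are distinct. -/
theorem conjWord_injective {G : Type*} [Group G] {A : Subgroup G} [A.Normal] {a u : G} (ha : a ∈ A)
    {f : G → ℂ} (hf : ∀ x ∈ A, ∀ y ∈ A, f (x * y) = f x + f y) {μ : ℂ} (hμ : μ ≠ 0)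
    (hμ' : ‖μ‖ ≤ 1 / 3) (hfu : ∀ x ∈ A, f (u * x * u⁻¹) = μ * f x) (hfa : f a ≠ 0)
    (l l' : List Bool) (hl : l.length = l'.length) (h : conjWord a u l = conjWord a u l') :
    l = l' := by
  have hf1 : f 1 = 0 := by simpa using hf 1 A.one_mem 1 A.one_mem
  have hcons : ∀ (e : Bool) (l : List Bool),
      f (conjWord a u (e :: l)) = (if e then f a else 0) + μ * f (conjWord a u l) := by
    intro e l
    have h2 := Subgroup.Normal.conj_mem (inferInstance : A.Normal) _ (conjWord_mem ha u l) u
    cases e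
    · simp [conjWord, hfu _ (conjWord_mem ha u l)]
    · simp [conjWord, hfu _ (conjWord_mem ha u l), hf _ ha _ h2]
  have hpos : 0 < ‖f a‖ := norm_pos_iff.2 hfa
  -- `3/2` is the sum of the geometric series of ratio `1/3`. After multiplication by `μ` the tails
  -- differ by at most `‖f a‖ / 2`, too little to offset a differing leading digit.
  have hdiff : ∀ l l' : List Bool, l.length = l'.length →
      ‖f (conjWord a u l) - f (conjWord a u l')‖ ≤ 3 / 2 * ‖f a‖ := by
    intro l
    induction l with
    | nil =>
      intro l' hl
      obtain rfl : l' = [] := List.length_eq_zero_iff.1 hl.symm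
      simp only [sub_self, norm_zero]
      positivity
    | cons e l ih =>
      intro l' hl
      cases l' with
      | nil => simp at hl
      | cons e' l' =>
        have hl : l.length = l'.length := by simpa using hl
        rw [hcons, hcons]
        have h1 : ‖(if e then f a else 0) - (if e' then f a else 0)‖ ≤ ‖f a‖ := by
          cases e <;> cases e' <;> simp
        calc _ = ‖((if e then f a else 0) - (if e' then f a else 0)) +
              μ * (f (conjWord a u l) - f (conjWord a u l'))‖ := by congr 1; ring
          _ ≤ ‖f a‖ + 1 / 3 * (3 / 2 * ‖f a‖) := by
            refine (norm_add_le _ _).trans (add_le_add h1 ?_)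
            rw [norm_mul]
            exact mul_le_mul hμ' (ih l' hl) (norm_nonneg _) (by norm_num)
          _ = _ := by ring
  suffices H : ∀ l l' : List Bool, l.length = l'.length →
      f (conjWord a u l) = f (conjWord a u l') → l = l' from H l l' hl (congrArg f h)
  intro l
  induction l with
  | nil =>
    intro l' hl _
    exact (List.length_eq_zero_iff.1 hl.symm).symm
  | cons e l ih =>
    intro l' hl h
    cases l' with
    | nil => simp at hl
    | cons e' l' =>
      replace hl : l.length = l'.length := by simpa using hl
      rw [hcons, hcons] at h
      have hne : ‖μ * (f (conjWord a u l) - f (conjWord a u l'))‖ < ‖f a‖ := by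
        rw [norm_mul]
        calc _ ≤ 1 / 3 * (3 / 2 * ‖f a‖) :=
              mul_le_mul hμ' (hdiff l l' hl) (norm_nonneg _) (by norm_num)
          _ < _ := by linarith
      have key : e = e' := by
        cases e <;> cases e' <;> simp only [Bool.false_eq_true, if_true, if_false, reduceCtorEq]
          at h ⊢
        · have : μ * (f (conjWord a u l) - f (conjWord a u l')) = f a := by linear_combination h
          rw [this] at hne
          exact lt_irrefl _ hne
        · have : μ * (f (conjWord a u l) - f (conjWord a u l')) = -f a := by linear_combination h
          rw [this, norm_neg] at hne
          exact lt_irrefl _ hne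
      subst key
      rw [ih l' hl (mul_left_cancel₀ hμ (add_left_cancel h))]

/-- Allows `u` to be replaced by a power whose contraction factor is below `1/3`. -/
theorem conj_pow_scale {G : Type*} [Group G] {A : Subgroup G} [A.Normal] {u : G}
    {f : G → ℂ} {μ : ℂ} (hfu : ∀ x ∈ A, f (u * x * u⁻¹) = μ * f x) (n : ℕ) :
    ∀ x ∈ A, f (u ^ n * x * (u ^ n)⁻¹) = μ ^ n * f x := by
  induction n with
  | zero => simp
  | succ n ih =>
    intro x hx
    have h := hfu _ (Subgroup.Normal.conj_mem (inferInstance : A.Normal) _ hx (u ^ n))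
    rw [ih x hx] at h
    rw [pow_succ' μ, mul_assoc μ, ← h]
    congr 1
    group

/-! ### Powers, lcm and the index estimate -/

theorem exists_lcmUpto_le_pow : ∃ E : ℕ, 1 ≤ E ∧ ∀ L : ℕ, Nat.lcmUpto L ≤ E ^ L := by
  refine ⟨⌈Real.exp (Real.log 4 + 4)⌉₊, Nat.one_le_ceil_iff.2 (Real.exp_pos _), fun L => ?_⟩
  have h := Chebyshev.psi_le_const_mul_self (x := L) (Nat.cast_nonneg L)
  rw [Chebyshev.psi_eq_log_lcmUpto,
    Real.log_le_iff_le_exp (by exact_mod_cast Nat.lcmUpto_pos L)] at h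
  have h2 : Real.exp ((Real.log 4 + 4) * L) = Real.exp (Real.log 4 + 4) ^ L := by
    rw [mul_comm, Real.exp_nat_mul]
  rw [h2] at h
  have h3 : ((Nat.lcmUpto L : ℕ) : ℝ) ≤ ((⌈Real.exp (Real.log 4 + 4)⌉₊ ^ L : ℕ) : ℝ) := by
    push_cast
    exact h.trans (pow_le_pow_left₀ (Real.exp_pos _).le (Nat.le_ceil _) L)
  exact_mod_cast h3

theorem dvd_lcmUpto {q L : ℕ} (hq : 0 < q) (hL : q ≤ L) : q ∣ Nat.lcmUpto L :=
  Finset.dvd_lcm (f := id) (Finset.mem_Icc.2 ⟨hq, hL⟩)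

/-- Among more than `d ^ m` elements of `A`, two differ by a `d`-th power from `A`; for abelian `A`
this bounds the index of `A ^ d` by `d ^ m`. -/
def PowerIndexBound {G : Type*} [Group G] (A : Subgroup G) (m : ℕ) : Prop :=
  ∀ d : ℕ, 0 < d → ∀ F : Finset G, (F : Set G) ⊆ A → d ^ m < F.card →
    ∃ x ∈ F, ∃ y ∈ F, x ≠ y ∧ ∃ c ∈ A, x⁻¹ * y = c ^ d

/-- Among more than `D ^ m` coset representatives two would differ by a `D`-th power, which lies in
`N`. -/
theorem PowerIndexBound.relIndex_le {G : Type*} [Group G] {A : Subgroup G} {m : ℕ}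
    (hA : PowerIndexBound A m) {N : Subgroup G} (hN : N.relIndex A ≠ 0) {D : ℕ} (hD : 0 < D)
    (hpow : ∀ a ∈ A, a ^ D ∈ N) : N.relIndex A ≤ D ^ m := by
  classical
  by_contra! hlt
  have : Finite (A ⧸ N.subgroupOf A) := Nat.finite_of_card_ne_zero hN
  have := Fintype.ofFinite (A ⧸ N.subgroupOf A)
  have hinj : Function.Injective (fun z : A ⧸ N.subgroupOf A => (z.out : G)) := by
    intro z w h
    rw [← z.out_eq', ← w.out_eq', Subtype.ext h]
  let F : Finset G := Finset.univ.image (fun z : A ⧸ N.subgroupOf A => (z.out : G))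
  have hF : F.card = N.relIndex A := by
    rw [Finset.card_image_of_injective _ hinj, Finset.card_univ, ← Nat.card_eq_fintype_card]
    rfl
  obtain ⟨x, hx, y, hy, hxy, c, hc, h⟩ := hA D hD F (by
    intro x hx
    simp only [F, Finset.coe_image, Finset.coe_univ, Set.image_univ, Set.mem_range] at hx
    obtain ⟨z, rfl⟩ := hx
    exact z.out.2) (hF ▸ hlt)
  simp only [F, Finset.mem_image, Finset.mem_univ, true_and] at hx hy
  obtain ⟨z, rfl⟩ := hx
  obtain ⟨w, rfl⟩ := hy
  apply hxy
  have : z = w := by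
    rw [← z.out_eq', ← w.out_eq']
    refine QuotientGroup.eq.2 ?_
    rw [Subgroup.mem_subgroupOf]
    push_cast
    rw [h]
    exact hpow c hc
  rw [this]

/-- The index of a finite-index normal subgroup is at least `q log q`, up to a constant, where
`q` is its relative index in `A`. -/
theorem relIndex_mul_log_le_index {G : Type*} [Group G] {A : Subgroup G} [A.Normal]
    (hcomm : ∀ x ∈ A, ∀ y ∈ A, x * y = y * x) {m : ℕ} (hA : PowerIndexBound A m) {t : G} {B : ℕ}
    (hB : ∀ k : ℕ, 0 < k → ∃ D : ℕ, 0 < D ∧ D ≤ B ^ k ∧ ∀ N : Subgroup G, N.Normal →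
      (∀ a ∈ A, t ^ k * a * (t ^ k)⁻¹ * a⁻¹ ∈ N) → ∀ a ∈ A, a ^ D ∈ N)
    {N : Subgroup G} [N.Normal] (hN : N.index ≠ 0) :
    (N.relIndex A : ℝ) * Real.log (N.relIndex A) ≤ m * Real.log B * N.index := by
  have hq : N.relIndex A ≠ 0 := fun h => hN (by
    have := Subgroup.relIndex_dvd_index_of_normal N A
    rw [h] at this
    exact zero_dvd_iff.1 this)
  have hidx : N.relIndex A * (A ⊔ N).index = N.index := by
    rw [← Subgroup.relIndex_sup_right A N]
    exact Subgroup.relIndex_mul_index le_sup_right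
  have hAN : (A ⊔ N).index ≠ 0 := fun h => hN (by rw [← hidx, h, mul_zero])
  obtain ⟨k, hk, hk', htk⟩ := Subgroup.exists_pow_mem_of_index_ne_zero hAN t
  obtain ⟨D, hD, hDB, hDN⟩ := hB k hk
  -- Write `t ^ k = b c` with `b ∈ A`, `c ∈ N`. As `b` commutes with `A`, conjugation by `t ^ k` is
  -- trivial on `A` modulo `N`.
  have hpow : ∀ a ∈ A, a ^ D ∈ N := by
    refine hDN N inferInstance fun a ha => ?_
    obtain ⟨b, hb, c, hc, hbc⟩ := Subgroup.mem_sup_of_normal_right.1 htk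
    rw [← hbc]
    have hac : a⁻¹ * b⁻¹ = b⁻¹ * a⁻¹ := hcomm _ (A.inv_mem ha) _ (A.inv_mem hb)
    have : b * c * a * (b * c)⁻¹ * a⁻¹ = b * (c * (a * c⁻¹ * a⁻¹)) * b⁻¹ *
        (b * a * b⁻¹ * a⁻¹) := by group
    have h1 : b * a * b⁻¹ * a⁻¹ = 1 := by rw [hcomm b hb a ha]; group
    rw [this, h1, mul_one]
    exact Subgroup.Normal.conj_mem inferInstance _
      (N.mul_mem hc (Subgroup.Normal.conj_mem inferInstance _ (N.inv_mem hc) a)) b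
  have hle : N.relIndex A ≤ B ^ (k * m) := (hA.relIndex_le hq hD hpow).trans (by
    rw [pow_mul]
    exact Nat.pow_le_pow_left hDB m)
  have hlog : Real.log (N.relIndex A) ≤ k * m * Real.log B := by
    have h : (N.relIndex A : ℝ) ≤ (B : ℝ) ^ (k * m) := by exact_mod_cast hle
    have := Real.log_le_log (by exact_mod_cast Nat.pos_of_ne_zero hq) h
    rwa [Real.log_pow, Nat.cast_mul] at this
  have hlogB : 0 ≤ Real.log B := Real.log_natCast_nonneg B
  calc (N.relIndex A : ℝ) * Real.log (N.relIndex A)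
      ≤ N.relIndex A * (k * m * Real.log B) := by gcongr
    _ ≤ N.relIndex A * ((A ⊔ N).index * m * Real.log B) := by gcongr
    _ = m * Real.log B * (N.relIndex A * (A ⊔ N).index : ℕ) := by push_cast; ring
    _ = _ := by rw [hidx]

/-! ### The general lower bound -/

/-- A lower bound for the residual finiteness growth of a group with a normal abelian subgroup `A`
on which `u` acts with a contracted coordinate, and on which powers of `t` act far from
trivially. -/
theorem growthLE_RF {G : Type*} [Group G] (hG : Group.ResiduallyFinite G) {A : Subgroup G}
    [A.Normal] (hcomm : ∀ x ∈ A, ∀ y ∈ A, x * y = y * x) {m : ℕ} (hA : PowerIndexBound A m)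
    {t : G} {B : ℕ}
    (hB : ∀ k : ℕ, 0 < k → ∃ D : ℕ, 0 < D ∧ D ≤ B ^ k ∧ ∀ N : Subgroup G, N.Normal →
      (∀ a ∈ A, t ^ k * a * (t ^ k)⁻¹ * a⁻¹ ∈ N) → ∀ a ∈ A, a ^ D ∈ N)
    {a u : G} (ha : a ∈ A) {f : G → ℂ} (hf : ∀ x ∈ A, ∀ y ∈ A, f (x * y) = f x + f y)
    {μ : ℂ} (hμ : μ ≠ 0) (hμ' : ‖μ‖ < 1) (hfu : ∀ x ∈ A, f (u * x * u⁻¹) = μ * f x)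
    (hfa : f a ≠ 0) (S : Finset G) (hS : Subgroup.closure (S : Set G) = ⊤) :
    GrowthLE (fun r => r * Real.log r) (fun r => (RF S r : ℝ)) := by
  classical
  obtain ⟨s, hs⟩ := exists_pow_lt_of_lt_one (show (0 : ℝ) < 1 / 3 by norm_num) hμ'
  have hinj := conjWord_injective ha hf (pow_ne_zero s hμ) (by rw [norm_pow]; exact hs.le)
    (conj_pow_scale hfu s) hfa
  obtain ⟨r₁, hr₁⟩ := exists_mem_wordBall hS a
  obtain ⟨r₂, hr₂⟩ := exists_mem_wordBall hS (u ^ s)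
  obtain ⟨ρ, hρ0, haρ, huρ⟩ : ∃ ρ : ℝ, 0 ≤ ρ ∧ a ∈ wordBall S ρ ∧ u ^ s ∈ wordBall S ρ :=
    ⟨max 0 (max r₁ r₂), le_max_left _ _,
      wordBall_mono ((le_max_left _ _).trans (le_max_right _ _)) hr₁,
      wordBall_mono ((le_max_right _ _).trans (le_max_right _ _)) hr₂⟩
  obtain ⟨E, hE, hlcm⟩ := exists_lcmUpto_le_pow
  have key : ∀ L : ℕ, 1 ≤ L → ∃ g ∈ wordBall S (L * (6 * E ^ m * ρ)), g ≠ 1 ∧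
      (L : ℝ) * Real.log L ≤ m * Real.log B * divisibility g := by
    intro L hL
    -- With `E ^ m * L` binary digits, `2 ^ (E ^ m) > E ^ m` gives more words than `E ^ (L m)`,
    -- which bounds the `m`-th power of the lcm.
    let w : (Fin (E ^ m * L) → Bool) → G := fun e => conjWord a (u ^ s) (List.ofFn e)
    have hw : Function.Injective w := fun e e' h =>
      List.ofFn_injective (hinj _ _ (by simp) h)
    have hcard : Nat.lcmUpto L ^ m < (Finset.univ.image w).card := by
      rw [Finset.card_image_of_injective _ hw]
      simp only [Finset.card_univ, Fintype.card_fun, Fintype.card_bool, Fintype.card_fin]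
      calc Nat.lcmUpto L ^ m ≤ (E ^ L) ^ m := Nat.pow_le_pow_left (hlcm L) m
        _ = (E ^ m) ^ L := by rw [← pow_mul, ← pow_mul, mul_comm]
        _ < (2 ^ E ^ m) ^ L := Nat.pow_lt_pow_left Nat.lt_two_pow_self (by omega)
        _ = _ := by rw [← pow_mul]
    obtain ⟨x, hx, y, hy, hxy, c, hc, h⟩ := hA _ (Nat.lcmUpto_pos L) _ (by
      intro x hx
      simp only [Finset.coe_image, Finset.coe_univ, Set.image_univ, Set.mem_range] at hx
      obtain ⟨e, rfl⟩ := hx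
      exact conjWord_mem ha _ _) hcard
    have hball : ∀ x ∈ Finset.univ.image w, x ∈ wordBall S ((E ^ m * L : ℕ) * (3 * ρ)) := by
      intro x hx
      simp only [Finset.mem_image, Finset.mem_univ, true_and] at hx
      obtain ⟨e, rfl⟩ := hx
      simpa using conjWord_mem_wordBall hρ0 haρ huρ (List.ofFn e)
    have hne : x⁻¹ * y ≠ 1 := fun h1 => hxy (inv_mul_eq_one.1 h1)
    refine ⟨x⁻¹ * y, ?_, hne, ?_⟩
    · convert mul_mem_wordBall (inv_mem_wordBall (hball x hx)) (hball y hy) using 1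
      push_cast
      ring_nf
    -- Residual finiteness makes the set of indices nonempty, so `divisibility` is attained by some
    -- `N` and is not the default `0`.
    · obtain ⟨H, hH⟩ := Group.exists_finiteIndexNormalSubgroup_notMem (x⁻¹ * y) hne
      have hmem : divisibility (x⁻¹ * y) ∈ {k : ℕ | ∃ N : Subgroup G, N.Normal ∧ N.FiniteIndex ∧
          x⁻¹ * y ∉ N ∧ N.index = k} :=
        Nat.sInf_mem ⟨_, H.toSubgroup, inferInstance, inferInstance, hH, rfl⟩
      obtain ⟨N, hN, hNfin, hgN, hNi⟩ := hmem
      have hNi0 : N.index ≠ 0 := hNfin.index_ne_zero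
      have hq : N.relIndex A ≠ 0 := fun h => hNi0 (by
        have := Subgroup.relIndex_dvd_index_of_normal N A
        rw [h] at this
        exact zero_dvd_iff.1 this)
      -- If `q < L`, all positive integers up to `q` divide the lcm, so the lcm-th power `c ^ _`
      -- falls into `N`.
      have hLq : L ≤ N.relIndex A := by
        by_contra! hlt
        refine hgN ?_
        rw [h]
        exact (Subgroup.mem_inf.1 (Subgroup.pow_mem_of_relIndex_ne_zero_of_dvd hq hc
          fun k hk hk' => dvd_lcmUpto hk (hk'.trans hlt.le))).1
      have h1 : (1 : ℝ) ≤ L := by exact_mod_cast hL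
      have h2 : (L : ℝ) ≤ N.relIndex A := by exact_mod_cast hLq
      rw [← hNi]
      refine le_trans ?_ (relIndex_mul_log_le_index hcomm hA hB hNi0)
      exact mul_le_mul h2 (Real.log_le_log (by linarith) h2) (Real.log_nonneg h1) (by linarith)
  have hlogB : 0 ≤ Real.log B := Real.log_natCast_nonneg B
  -- `12 E ^ m ρ` covers the word length, since two words cost `6 E ^ m ρ` per unit of `L` and `⌈r⌉
  -- ≤ 2r`; `m log B` comes from the index estimate, and `1` ensures positivity.
  refine ⟨12 * E ^ m * ρ + m * Real.log B + 1, by positivity, fun r hr => ?_⟩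
  have hr1 : 1 ≤ r := (le_max_left _ _).trans hr
  obtain ⟨g, hg, hg1, hgd⟩ := key ⌈r⌉₊ (Nat.one_le_ceil_iff.2 (by linarith))
  have hle : r ≤ ⌈r⌉₊ := Nat.le_ceil r
  have hle2 : (⌈r⌉₊ : ℝ) ≤ 2 * r := by linarith [Nat.ceil_lt_add_one (show 0 ≤ r by linarith)]
  have hmem : g ∈ wordBall S ((12 * E ^ m * ρ + m * Real.log B + 1) * r) := by
    refine wordBall_mono ?_ hg
    have h1 : (⌈r⌉₊ : ℝ) * (6 * E ^ m * ρ) ≤ 2 * r * (6 * E ^ m * ρ) := by gcongr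
    have h2 : 0 ≤ (m * Real.log B + 1) * r := by positivity
    linarith
  have hRF : (divisibility g : ℝ) ≤
      (RF S ((12 * E ^ m * ρ + m * Real.log B + 1) * r) : ℝ) := by
    exact_mod_cast divisibility_le_RF S _ hmem hg1
  calc r * Real.log r ≤ ⌈r⌉₊ * Real.log ⌈r⌉₊ :=
        mul_le_mul hle (Real.log_le_log (by linarith) hle) (Real.log_nonneg hr1) (by positivity)
    _ ≤ m * Real.log B * divisibility g := hgd
    _ ≤ (12 * E ^ m * ρ + m * Real.log B + 1) * divisibility g := by
      gcongr
      have : 0 ≤ 12 * (E : ℝ) ^ m * ρ := by positivity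
      linarith
    _ ≤ _ := by gcongr

/-- A nonzero integer `k` survives modulo `|k| + 1`. -/
theorem exists_finiteIndex_notMem_of_hom_int {G : Type*} [Group G] (π : G →* Multiplicative ℤ)
    {g : G} (hg : π g ≠ 1) : ∃ H : Subgroup G, H.FiniteIndex ∧ g ∉ H := by
  let k : ℤ := (π g).toAdd
  have hk : k ≠ 0 := fun h => hg (toAdd_eq_zero.1 h)
  let ψ : G →* Multiplicative (ZMod (k.natAbs + 1)) :=
    (AddMonoidHom.toMultiplicative (Int.castAddHom (ZMod (k.natAbs + 1)))).comp π
  refine ⟨ψ.ker, Subgroup.finiteIndex_ker ψ, fun h => ?_⟩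
  have h1 : ((k : ℤ) : ZMod (k.natAbs + 1)) = 0 := congrArg Multiplicative.toAdd h
  rw [ZMod.intCast_zmod_eq_zero_iff_dvd] at h1
  have := Int.natAbs_dvd_natAbs.2 h1
  rw [Int.natAbs_natCast] at this
  have := Nat.le_of_dvd (Int.natAbs_pos.2 hk) this
  omega

/-! ### Eigenvalues and determinants of integer matrices -/

/-- Kronecker's theorem: a nonzero complex root of a monic integer polynomial all of whose complex
roots lie in the closed unit disc is a root of unity. -/
theorem Polynomial.pow_eq_one_of_forall_root_norm_le_one {p : Polynomial ℤ} (hp : p.Monic)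
    (hroots : ∀ z : ℂ, p.aeval z = 0 → ‖z‖ ≤ 1) {z : ℂ} (hz : p.aeval z = 0) (hz0 : z ≠ 0) :
    ∃ n : ℕ, 0 < n ∧ z ^ n = 1 := by
  have hint : IsIntegral ℤ z := ⟨p, hp, hz⟩
  let K := IntermediateField.adjoin ℚ {z}
  let : NumberField K := {
    to_charZero := K.charZero,
    to_finiteDimensional := IntermediateField.adjoin.finiteDimensional hint.tower_top }
  let y : K := ⟨z, IntermediateField.mem_adjoin_simple_self ℚ z⟩
  have H (ψ : K →+* ℂ) : ψ (p.aeval y) = p.aeval (ψ y) := by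
    conv_rhs => rw [← Polynomial.map_id (p := p)]
    exact p.map_aeval_eq_aeval_map (by ext; simp) y
  have hy : p.aeval y = 0 := by
    apply (algebraMap K ℂ).injective
    rw [H, map_zero]
    exact hz
  -- Every complex embedding sends `y` to a root of `p`, so all conjugates of `z` have modulus at
  -- most `1`.
  obtain ⟨n, hn, h⟩ := NumberField.Embeddings.pow_eq_one_of_norm_le_one (x := y) K ℂ
    (fun h => hz0 (congrArg (algebraMap K ℂ) h)) (IntermediateField.coe_isIntegral_iff.mp hint)
    fun φ => hroots _ (by rw [← H, hy, map_zero])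
  exact ⟨n, hn, congrArg (algebraMap K ℂ) h⟩

theorem isComplexEigenvalue_iff {m : ℕ} (M : Matrix (Fin m) (Fin m) ℤ) (μ : ℂ) :
    IsComplexEigenvalue M μ ↔ μ ∈ spectrum ℂ (M.map (Int.cast : ℤ → ℂ)) := by
  rw [IsComplexEigenvalue, Module.End.hasEigenvalue_iff_mem_spectrum, Matrix.spectrum_toLin']

theorem isComplexEigenvalue_iff_aeval_charpoly {m : ℕ} (M : Matrix (Fin m) (Fin m) ℤ) (μ : ℂ) :
    IsComplexEigenvalue M μ ↔ M.charpoly.aeval μ = 0 := by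
  rw [isComplexEigenvalue_iff, Matrix.mem_spectrum_iff_isRoot_charpoly,
    show M.map (Int.cast : ℤ → ℂ) = M.map (Int.castRingHom ℂ) from rfl, Matrix.charpoly_map,
    Polynomial.IsRoot.def, Polynomial.eval_map, Polynomial.aeval_def]
  rfl

theorem not_isComplexEigenvalue_zero {m : ℕ} (M : GL (Fin m) ℤ) :
    ¬ IsComplexEigenvalue (M : Matrix (Fin m) (Fin m) ℤ) 0 := by
  rw [isComplexEigenvalue_iff, spectrum.zero_mem_iff, not_not]
  exact M.isUnit.map (Int.castRingHom ℂ).mapMatrix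

/-- Otherwise Kronecker's theorem for the characteristic polynomial makes any eigenvalue a root of
unity; `0` is excluded by invertibility, and `0 < m` ensures that an eigenvalue exists. -/
theorem exists_isComplexEigenvalue_one_lt_norm {m : ℕ} (hm : 0 < m) (M : GL (Fin m) ℤ)
    (hM : ∀ μ : ℂ, IsComplexEigenvalue (M : Matrix (Fin m) (Fin m) ℤ) μ →
      ∀ k : ℕ, 0 < k → μ ^ k ≠ 1) :
    ∃ μ : ℂ, IsComplexEigenvalue (M : Matrix (Fin m) (Fin m) ℤ) μ ∧ 1 < ‖μ‖ := by
  by_contra! h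
  have : NeZero m := ⟨hm.ne'⟩
  obtain ⟨z, hz⟩ := spectrum.nonempty_of_isAlgClosed_of_finiteDimensional ℂ
    ((M : Matrix (Fin m) (Fin m) ℤ).map (Int.cast : ℤ → ℂ))
  rw [← isComplexEigenvalue_iff] at hz
  obtain ⟨k, hk, hzk⟩ := Polynomial.pow_eq_one_of_forall_root_norm_le_one
    (M : Matrix (Fin m) (Fin m) ℤ).charpoly_monic
    (fun w hw => h w ((isComplexEigenvalue_iff_aeval_charpoly _ w).2 hw))
    ((isComplexEigenvalue_iff_aeval_charpoly _ z).1 hz)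
    (fun h0 => not_isComplexEigenvalue_zero M (h0 ▸ hz))
  exact hM z hz k hk hzk

/-- A left eigenvector is a linear functional on which `M` acts by the scalar `μ`; it serves as the
coordinate `f`. -/
theorem IsComplexEigenvalue.exists_vecMul {m : ℕ} {M : Matrix (Fin m) (Fin m) ℤ} {μ : ℂ}
    (h : IsComplexEigenvalue M μ) :
    ∃ w : Fin m → ℂ, w ≠ 0 ∧ w ᵥ* M.map (Int.cast : ℤ → ℂ) = μ • w := by
  rw [isComplexEigenvalue_iff, Matrix.mem_spectrum_iff_isRoot_charpoly, Polynomial.IsRoot.def,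
    Matrix.eval_charpoly, ← Matrix.exists_vecMul_eq_zero_iff] at h
  obtain ⟨w, hw, h⟩ := h
  refine ⟨w, hw, ?_⟩
  rw [Matrix.vecMul_sub, sub_eq_zero] at h
  rw [← h]
  ext i
  simp [Matrix.scalar_apply, Matrix.vecMul_diagonal, mul_comm]

theorem det_pow_sub_one_ne_zero {m : ℕ} {M : Matrix (Fin m) (Fin m) ℤ} {k : ℕ} (hk : 0 < k)
    (hM : ∀ μ : ℂ, IsComplexEigenvalue M μ → μ ^ k ≠ 1) : (M ^ k - 1).det ≠ 0 := by
  intro h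
  have h1 : (1 : ℂ) ∈ spectrum ℂ (M.map (Int.cast : ℤ → ℂ) ^ k) := by
    rw [Matrix.mem_spectrum_iff_isRoot_charpoly, Polynomial.IsRoot.def, Matrix.eval_charpoly,
      ← neg_sub, Matrix.det_neg, map_one]
    have h2 := congrArg (Int.castRingHom ℂ) h
    rw [RingHom.map_det, map_sub, map_pow, map_one, map_zero] at h2
    exact mul_eq_zero_of_right _ h2
  rw [spectrum.map_pow_of_pos _ hk] at h1
  obtain ⟨μ, hμ, hμk⟩ := h1
  exact hM μ ((isComplexEigenvalue_iff M μ).2 hμ) hμk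

theorem exists_natAbs_det_pow_sub_one_le {m : ℕ} (M : Matrix (Fin m) (Fin m) ℤ) :
    ∃ B : ℕ, ∀ k : ℕ, 0 < k → (M ^ k - 1).det.natAbs ≤ B ^ k := by
  obtain ⟨c, hc1, hc⟩ : ∃ c : ℕ, 1 ≤ c ∧ ∀ i j, |M i j| ≤ c := by
    refine ⟨1 + ∑ i, ∑ j, (M i j).natAbs, by omega, fun i j => ?_⟩
    rw [Int.abs_eq_natAbs]
    have h1 := Finset.single_le_sum (f := fun j => (M i j).natAbs) (fun _ _ => Nat.zero_le _)
      (Finset.mem_univ j)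
    have h2 := Finset.single_le_sum (f := fun i => ∑ j, (M i j).natAbs)
      (fun _ _ => Nat.zero_le _) (Finset.mem_univ i)
    exact_mod_cast (h1.trans h2).trans (Nat.le_add_left _ 1)
  have hpow : ∀ k : ℕ, ∀ i j, |(M ^ k) i j| ≤ (m * c : ℤ) ^ k := by
    intro k
    induction k with
    | zero =>
      intro i j
      rw [pow_zero, pow_zero, Matrix.one_apply]
      split_ifs <;> simp
    | succ k ih =>
      intro i j
      rw [pow_succ, Matrix.mul_apply]
      calc |∑ l, (M ^ k) i l * M l j| ≤ ∑ l : Fin m, (m * c : ℤ) ^ k * c := by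
            refine (Finset.abs_sum_le_sum_abs _ _).trans (Finset.sum_le_sum fun l _ => ?_)
            rw [abs_mul]
            exact mul_le_mul (ih i l) (hc l j) (abs_nonneg _) (by positivity)
        _ = _ := by
          rw [Finset.sum_const, Finset.card_univ, Fintype.card_fin, nsmul_eq_mul]
          ring
  -- The Leibniz expansion has `m!` terms. For `k ≥ 1` both `m!` and the factor `2` in the entry
  -- bound are absorbed into `k`-th powers.
  refine ⟨m.factorial * (2 * (m * c)) ^ m, fun k hk => ?_⟩
  have hent : ∀ i j, AbsoluteValue.abs ((M ^ k - 1) i j) ≤ (2 * (m * c) : ℤ) ^ k := by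
    intro i j
    have hmc : (1 : ℤ) ≤ m * c := by
      have : 0 < m := i.pos
      exact_mod_cast Nat.mul_pos this hc1
    rw [AbsoluteValue.abs_apply, Matrix.sub_apply]
    have h1 : |(1 : Matrix (Fin m) (Fin m) ℤ) i j| ≤ 1 := by
      rw [Matrix.one_apply]
      split_ifs <;> simp
    have h2 : (1 : ℤ) ≤ (m * c : ℤ) ^ k := one_le_pow₀ hmc
    have h3 : (2 : ℤ) ≤ 2 ^ k := le_self_pow₀ (by norm_num) hk.ne'
    calc _ ≤ (m * c : ℤ) ^ k + 1 := (abs_sub _ _).trans (add_le_add (hpow k i j) h1)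
      _ ≤ 2 * (m * c : ℤ) ^ k := by linarith
      _ ≤ 2 ^ k * (m * c : ℤ) ^ k := by gcongr
      _ = _ := (mul_pow _ _ _).symm
  have h := Matrix.det_le hent
  rw [AbsoluteValue.abs_apply, Int.abs_eq_natAbs, Fintype.card_fin, nsmul_eq_mul] at h
  have h' : (M ^ k - 1).det.natAbs ≤ m.factorial * ((2 * (m * c)) ^ k) ^ m := by exact_mod_cast h
  refine h'.trans ?_
  rw [mul_pow m.factorial, ← pow_mul, ← pow_mul, mul_comm k m]
  exact Nat.mul_le_mul_right _ (Nat.le_self_pow hk.ne' _)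

/-! ### The groups `ℤ^m ⋊ ℤ` -/

namespace MatrixSemidirect

variable {m : ℕ} (M : GL (Fin m) ℤ)

/-- The element `(v, 0)` of `ℤ^m ⋊_M ℤ`. -/
def ofVec (v : Fin m → ℤ) : MatrixSemidirect M := SemidirectProduct.inl (Multiplicative.ofAdd v)

/-- The element `(0, 1)` of `ℤ^m ⋊_M ℤ`, which acts on `ℤ^m` by `M`. -/
def stable : MatrixSemidirect M := SemidirectProduct.inr (Multiplicative.ofAdd 1)

/-- The subgroup `ℤ^m` of `ℤ^m ⋊_M ℤ`. -/
abbrev base : Subgroup (MatrixSemidirect M) :=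
  (SemidirectProduct.rightHom : MatrixSemidirect M →* Multiplicative ℤ).ker

/-- The `ℤ^m`-component of an element. -/
def vec (g : MatrixSemidirect M) : Fin m → ℤ := Multiplicative.toAdd g.left

@[simp] theorem vec_ofVec (v : Fin m → ℤ) : vec M (ofVec M v) = v := rfl

theorem ofVec_add (v w : Fin m → ℤ) : ofVec M (v + w) = ofVec M v * ofVec M w := by
  simp [ofVec]

theorem ofVec_neg (v : Fin m → ℤ) : ofVec M (-v) = (ofVec M v)⁻¹ := by
  simp [ofVec]

theorem ofVec_nsmul (d : ℕ) (v : Fin m → ℤ) : ofVec M (d • v) = ofVec M v ^ d :=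
  map_pow SemidirectProduct.inl (Multiplicative.ofAdd v) d

theorem ofVec_mem (v : Fin m → ℤ) : ofVec M v ∈ base M := by
  simp [ofVec, MonoidHom.mem_ker]

theorem ofVec_vec {g : MatrixSemidirect M} (hg : g ∈ base M) : ofVec M (vec M g) = g := by
  refine SemidirectProduct.ext rfl ?_
  exact (MonoidHom.mem_ker.1 hg).symm

theorem stable_mul_ofVec_mul_inv (v : Fin m → ℤ) : stable M * ofVec M v * (stable M)⁻¹ =
    ofVec M ((M : Matrix (Fin m) (Fin m) ℤ) *ᵥ v) := by
  rw [ofVec, ofVec, ← matrixAction_one, SemidirectProduct.inl_aut, map_inv]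
  rfl

theorem stable_pow_mul_ofVec_mul_inv (k : ℕ) (v : Fin m → ℤ) :
    stable M ^ k * ofVec M v * (stable M ^ k)⁻¹ =
      ofVec M (((M : Matrix (Fin m) (Fin m) ℤ) ^ k) *ᵥ v) := by
  induction k with
  | zero => simp
  | succ k ih =>
    rw [pow_succ' (M : Matrix (Fin m) (Fin m) ℤ), ← Matrix.mulVec_mulVec,
      ← stable_mul_ofVec_mul_inv, ← ih]
    group

theorem base_comm : ∀ x ∈ base M, ∀ y ∈ base M, x * y = y * x := by
  intro x hx y hy
  rw [← ofVec_vec M hx, ← ofVec_vec M hy, ← ofVec_add, ← ofVec_add, add_comm]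

theorem powerIndexBound_base : PowerIndexBound (base M) m := by
  classical
  intro d hd F hF hcard
  have : NeZero d := ⟨hd.ne'⟩
  obtain ⟨x, hx, y, hy, hxy, h⟩ := Finset.exists_ne_map_eq_of_card_lt_of_maps_to
    (s := F) (t := (Finset.univ : Finset (Fin m → ZMod d)))
    (by simpa [ZMod.card] using hcard)
    (f := fun x i => (vec M x i : ZMod d)) (by simp [Set.MapsTo])
  have hdvd : ∀ i, ∃ c : ℤ, vec M y i - vec M x i = d * c := fun i =>
    (ZMod.intCast_eq_intCast_iff_dvd_sub _ _ _).1 (congrFun h i)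
  choose c hc using hdvd
  refine ⟨x, hx, y, hy, hxy, ofVec M c, ofVec_mem M c, ?_⟩
  rw [← ofVec_nsmul, ← ofVec_vec M (hF hx), ← ofVec_vec M (hF hy), ← ofVec_neg, ← ofVec_add]
  congr 1
  ext i
  simp only [Pi.add_apply, Pi.neg_apply, Pi.smul_apply, nsmul_eq_mul, ← hc]
  ring

/-- `N` contains the image of `P = M ^ k - 1`, and `P (adj P) v = det P • v`. -/
theorem pow_natAbs_det_mem {k : ℕ} {N : Subgroup (MatrixSemidirect M)}
    (hN : ∀ a ∈ base M, stable M ^ k * a * (stable M ^ k)⁻¹ * a⁻¹ ∈ N)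
    {a : MatrixSemidirect M} (ha : a ∈ base M) :
    a ^ ((M : Matrix (Fin m) (Fin m) ℤ) ^ k - 1).det.natAbs ∈ N := by
  set P := (M : Matrix (Fin m) (Fin m) ℤ) ^ k - 1 with hP
  have h := hN _ (ofVec_mem M (P.adjugate *ᵥ vec M a))
  rw [stable_pow_mul_ofVec_mul_inv, ← ofVec_neg, ← ofVec_add, ← sub_eq_add_neg] at h
  have h2 : (M : Matrix (Fin m) (Fin m) ℤ) ^ k *ᵥ P.adjugate *ᵥ vec M a -
      P.adjugate *ᵥ vec M a = P.det • vec M a := by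
    have h3 : ∀ u, (M : Matrix (Fin m) (Fin m) ℤ) ^ k *ᵥ u - u = P *ᵥ u := fun u => by
      rw [hP, Matrix.sub_mulVec, Matrix.one_mulVec]
    rw [h3, Matrix.mulVec_mulVec, Matrix.mul_adjugate, Matrix.smul_mulVec, Matrix.one_mulVec]
  rw [h2] at h
  rw [← ofVec_vec M ha, ← ofVec_nsmul]
  rcases Int.natAbs_eq P.det with h3 | h3
  · rw [h3] at h
    simpa using h
  · rw [h3, neg_smul, ofVec_neg, inv_mem_iff] at h
    simpa using h

theorem fg : Group.FG (MatrixSemidirect M) := by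
  rw [Group.fg_def]
  have h : (⊤ : Subgroup (MatrixSemidirect M)) =
      (SemidirectProduct.inl : _ →* MatrixSemidirect M).range ⊔
        (SemidirectProduct.inr : _ →* MatrixSemidirect M).range := by
    refine (eq_top_iff.2 fun x _ => ?_).symm
    rw [← SemidirectProduct.inl_left_mul_inr_right x]
    exact Subgroup.mul_mem_sup ⟨_, rfl⟩ ⟨_, rfl⟩
  rw [h]
  exact ((Group.fg_iff_subgroup_fg _).1 inferInstance).sup
    ((Group.fg_iff_subgroup_fg _).1 inferInstance)

/-- The elements whose `ℤ^m`-component is divisible by `d`. -/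
def dvdSubgroup (d : ℕ) : Subgroup (MatrixSemidirect M) where
  carrier := {g | ∃ w, g.left = w ^ d}
  one_mem' := ⟨1, by simp⟩
  mul_mem' := by
    rintro a b ⟨v, hv⟩ ⟨w, hw⟩
    exact ⟨v * matrixAction M a.right w, by
      rw [SemidirectProduct.mul_left, hv, hw, map_pow, mul_pow]⟩
  inv_mem' := by
    rintro a ⟨v, hv⟩
    exact ⟨matrixAction M a.right⁻¹ v⁻¹, by
      rw [SemidirectProduct.inv_left, hv, ← map_pow, inv_pow]⟩

/-- The coordinates modulo `d` determine the left coset. Normality is not needed: finite index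
suffices for residual finiteness. -/
theorem finiteIndex_dvdSubgroup {d : ℕ} (hd : 0 < d) : (dvdSubgroup M d).FiniteIndex := by
  have : NeZero d := ⟨hd.ne'⟩
  have hinj : Function.Injective (fun z : MatrixSemidirect M ⧸ dvdSubgroup M d =>
      fun i => (vec M z.out i : ZMod d)) := by
    intro z w h
    have hdvd : ∀ i, ∃ c : ℤ, vec M w.out i - vec M z.out i = d * c := fun i =>
      (ZMod.intCast_eq_intCast_iff_dvd_sub _ _ _).1 (congrFun h i)
    choose c hc using hdvd
    rw [← z.out_eq', ← w.out_eq']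
    refine QuotientGroup.eq.2 ⟨matrixAction M z.out.right⁻¹ (Multiplicative.ofAdd c), ?_⟩
    rw [SemidirectProduct.mul_left, SemidirectProduct.inv_left, SemidirectProduct.inv_right,
      ← map_mul, ← map_pow]
    congr 1
    apply Multiplicative.toAdd.injective
    ext i
    have := hc i
    simp only [vec] at this
    simp only [toAdd_mul, toAdd_inv, toAdd_pow, toAdd_ofAdd, Pi.add_apply, Pi.neg_apply,
      Pi.smul_apply, nsmul_eq_mul, ← this]
    ring
  have := Finite.of_injective _ hinj
  exact Subgroup.finiteIndex_of_finite_quotient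

theorem residuallyFinite : Group.ResiduallyFinite (MatrixSemidirect M) := by
  rw [Group.residuallyFinite_iff_exists_finiteIndex]
  intro g hg
  by_cases hr : SemidirectProduct.rightHom g = 1
  · have hv : vec M g ≠ 0 := by
      intro h
      apply hg
      rw [← ofVec_vec M (MonoidHom.mem_ker.2 hr), h]
      rfl
    obtain ⟨i, hi⟩ := Function.ne_iff.1 hv
    refine ⟨_, finiteIndex_dvdSubgroup M (Nat.succ_pos (vec M g i).natAbs), ?_⟩
    rintro ⟨w, hw⟩
    have h1 : vec M g i = ((vec M g i).natAbs + 1 : ℕ) * (Multiplicative.toAdd w) i := by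
      conv_lhs => rw [vec, hw]
      simp
    have h2 : ((vec M g i).natAbs + 1 : ℕ) ∣ (vec M g i).natAbs := by
      rw [← Int.natCast_dvd]
      exact ⟨_, h1⟩
    have := Nat.le_of_dvd (Int.natAbs_pos.2 hi) h2
    omega
  · exact exists_finiteIndex_notMem_of_hom_int _ hr

theorem growthLE_RF (hm : 0 < m)
    (hM : ∀ μ : ℂ, IsComplexEigenvalue (M : Matrix (Fin m) (Fin m) ℤ) μ →
      ∀ k : ℕ, 0 < k → μ ^ k ≠ 1) (S : Finset (MatrixSemidirect M))
    (hS : Subgroup.closure (S : Set (MatrixSemidirect M)) = ⊤) :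
    GrowthLE (fun r => r * Real.log r) (fun r => (RF S r : ℝ)) := by
  obtain ⟨μ, hμ, hμ1⟩ := exists_isComplexEigenvalue_one_lt_norm hm M hM
  have hμ0 : μ ≠ 0 := by
    rintro rfl
    norm_num at hμ1
  obtain ⟨w, hw, hwM⟩ := hμ.exists_vecMul
  obtain ⟨j, hj⟩ := Function.ne_iff.1 hw
  obtain ⟨B, hB⟩ := exists_natAbs_det_pow_sub_one_le (M : Matrix (Fin m) (Fin m) ℤ)
  let f : MatrixSemidirect M → ℂ := fun g => w ⬝ᵥ fun i => (vec M g i : ℂ)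
  have hf : ∀ x ∈ base M, ∀ y ∈ base M, f (x * y) = f x + f y := by
    intro x hx y hy
    rw [← ofVec_vec M hx, ← ofVec_vec M hy, ← ofVec_add]
    simp only [f, vec_ofVec, ← dotProduct_add]
    congr 1
    ext i
    simp
  have hft : ∀ x ∈ base M, f (stable M * x * (stable M)⁻¹) = μ * f x := by
    intro x hx
    rw [← ofVec_vec M hx, stable_mul_ofVec_mul_inv]
    simp only [f, vec_ofVec]
    rw [← smul_eq_mul, ← smul_dotProduct, ← hwM, ← Matrix.dotProduct_mulVec]
    congr 1
    ext i
    simp [Matrix.mulVec, dotProduct]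
  -- `M` expands `f` by `μ`, so the contracting element is the inverse of `stable M`. The basis
  -- vector at `j` has `f`-value `w j ≠ 0`.
  refine _root_.growthLE_RF (residuallyFinite M) (base_comm M) (powerIndexBound_base M)
    (t := stable M) (B := B) ?_ (ofVec_mem M (Pi.single j 1)) (u := (stable M)⁻¹) hf
    (inv_ne_zero hμ0) (by rw [norm_inv]; exact inv_lt_one_of_one_lt₀ hμ1) ?_ ?_ S hS
  · intro k hk
    exact ⟨_, Int.natAbs_pos.2 (det_pow_sub_one_ne_zero hk fun μ hμ => hM μ hμ k hk), hB k hk,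
      fun N _ hN a ha => pow_natAbs_det_mem M hN ha⟩
  · intro x hx
    have h := hft _ (Subgroup.Normal.conj_mem (inferInstance : (base M).Normal) x hx (stable M)⁻¹)
    rw [eq_inv_mul_iff_mul_eq₀ hμ0, ← h]
    congr 1
    group
  · have : (fun i => ((Pi.single j 1 : Fin m → ℤ) i : ℂ)) = Pi.single j 1 := by
      ext i
      simp [Pi.single_apply]
    simp only [f, vec_ofVec, this, dotProduct_single, mul_one]
    exact hj

end MatrixSemidirect

/-! ### The groups `BS(1,n)` -/

namespace BaumslagSolitar

variable (n : ℤ)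

/-- The generator `x`. -/
def x : BaumslagSolitar n := PresentedGroup.of 0

/-- The generator `y`. -/
def y : BaumslagSolitar n := PresentedGroup.of 1

theorem relation : (y n)⁻¹ * x n * y n = x n ^ n := by
  have h := PresentedGroup.one_of_mem (rels := ({(FreeGroup.of 1)⁻¹ * FreeGroup.of 0 *
    FreeGroup.of 1 * (FreeGroup.of 0 ^ n)⁻¹} : Set (FreeGroup (Fin 2)))) (Set.mem_singleton _)
  rw [map_mul, map_inv, map_zpow] at h
  rw [← mul_inv_eq_one]
  exact h

/-- The homomorphism out of `BS(1,n)` given by two elements satisfying the relation. -/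
def lift {H : Type*} [Group H] (a b : H) (h : b⁻¹ * a * b = a ^ n) : BaumslagSolitar n →* H :=
  PresentedGroup.toGroup (f := ![a, b]) (by
    rintro r rfl
    simp [h])

@[simp] theorem lift_x {H : Type*} [Group H] {a b : H} (h : b⁻¹ * a * b = a ^ n) :
    lift n a b h (x n) = a := by
  simp [lift, x]

@[simp] theorem lift_y {H : Type*} [Group H] {a b : H} (h : b⁻¹ * a * b = a ^ n) :
    lift n a b h (y n) = b := by
  simp [lift, y]

theorem inv_mul_x_zpow_mul (e : ℤ) : (y n)⁻¹ * x n ^ e * y n = x n ^ (n * e) := by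
  have h := conj_zpow (i := e) (a := (y n)⁻¹) (b := x n)
  rw [inv_inv, relation, ← zpow_mul] at h
  exact h.symm

theorem inv_pow_mul_x_zpow_mul (k : ℕ) (e : ℤ) :
    (y n ^ k)⁻¹ * x n ^ e * y n ^ k = x n ^ (n ^ k * e) := by
  induction k generalizing e with
  | zero => simp
  | succ k ih =>
    rw [pow_succ n, mul_assoc (n ^ k), ← ih, ← inv_mul_x_zpow_mul]
    group

/-- The relation moves powers of `x` rightwards past `y ^ i` and `y⁻¹` rightwards past powers of
`x`, so these forms are stable under left multiplication by the generators and their inverses. -/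
theorem exists_eq (g : BaumslagSolitar n) :
    ∃ (i j : ℕ) (e : ℤ), g = y n ^ i * x n ^ e * (y n ^ j)⁻¹ := by
  have hx : ∀ (s : ℤ) (i j : ℕ) (e : ℤ), x n ^ s * (y n ^ i * x n ^ e * (y n ^ j)⁻¹) =
      y n ^ i * x n ^ (n ^ i * s + e) * (y n ^ j)⁻¹ := by
    intro s i j e
    rw [zpow_add, ← inv_pow_mul_x_zpow_mul]
    group
  have hg : g ∈ Subgroup.closure (Set.range (PresentedGroup.of : Fin 2 → BaumslagSolitar n)) := by
    rw [PresentedGroup.closure_range_of]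
    trivial
  induction hg using Subgroup.closure_induction_left with
  | one => exact ⟨0, 0, 0, by simp⟩
  | mul_left a ha b _ ih =>
    obtain ⟨i, j, e, rfl⟩ := ih
    obtain ⟨c, rfl⟩ := ha
    fin_cases c
    · exact ⟨i, j, _, (by rw [← hx 1 i j e, zpow_one]; rfl)⟩
    · change ∃ i' j' e', y n * _ = _
      refine ⟨i + 1, j, e, ?_⟩
      rw [pow_succ']
      group
  | inv_mul_cancel a ha b _ ih =>
    obtain ⟨i, j, e, rfl⟩ := ih
    obtain ⟨c, rfl⟩ := ha
    fin_cases c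
    · exact ⟨i, j, _, (by rw [← hx (-1) i j e, zpow_neg_one]; rfl)⟩
    · change ∃ i' j' e', (y n)⁻¹ * _ = _
      rcases i with _ | i
      · refine ⟨0, j + 1, n * e, ?_⟩
        rw [← inv_mul_x_zpow_mul]
        group
      · refine ⟨i, j, e, ?_⟩
        rw [pow_succ']
        group

/-- The homomorphism to `ℤ` with `x ↦ 0` and `y ↦ 1`. -/
def height : BaumslagSolitar n →* Multiplicative ℤ :=
  lift n 1 (Multiplicative.ofAdd 1) (by simp)

@[simp] theorem height_x : height n (x n) = 1 := lift_x n _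

@[simp] theorem height_y : height n (y n) = Multiplicative.ofAdd 1 := lift_y n _

theorem y_pow_mul_mem (i : ℕ) (e : ℤ) : y n ^ i * x n ^ e * (y n ^ i)⁻¹ ∈ (height n).ker := by
  simp [MonoidHom.mem_ker]

theorem y_pow_add_mul (i l : ℕ) (e : ℤ) : y n ^ i * x n ^ e * (y n ^ i)⁻¹ =
    y n ^ (i + l) * x n ^ (n ^ l * e) * (y n ^ (i + l))⁻¹ := by
  rw [← inv_pow_mul_x_zpow_mul, pow_add]
  group

/-- The kernel is the increasing union of the cyclic groups `⟨y^i x y^{-i}⟩`, so finitely many of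
its elements lie in a common one. Commutativity and the power index bound with `m = 1` follow from
this. -/
theorem exists_forall_ge_of_mem {a : BaumslagSolitar n} (ha : a ∈ (height n).ker) :
    ∃ I : ℕ, ∀ i, I ≤ i → ∃ e : ℤ, a = y n ^ i * x n ^ e * (y n ^ i)⁻¹ := by
  obtain ⟨i, j, e, rfl⟩ := exists_eq n a
  have hij : i = j := by
    have h : height n _ = 1 := ha
    simp only [map_mul, map_inv, map_pow, map_zpow, height_x, height_y, one_zpow, mul_one,
      mul_inv_eq_one] at h
    have h := congrArg Multiplicative.toAdd h
    simpa using h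
  subst hij
  refine ⟨i, fun i' hi => ?_⟩
  obtain ⟨l, rfl⟩ := Nat.exists_eq_add_of_le hi
  exact ⟨_, y_pow_add_mul n i l e⟩

theorem ker_comm : ∀ a ∈ (height n).ker, ∀ b ∈ (height n).ker, a * b = b * a := by
  intro a ha b hb
  obtain ⟨I, hI⟩ := exists_forall_ge_of_mem n ha
  obtain ⟨J, hJ⟩ := exists_forall_ge_of_mem n hb
  obtain ⟨e, rfl⟩ := hI _ (le_max_left I J)
  obtain ⟨e', rfl⟩ := hJ _ (le_max_right I J)
  rw [conj_mul, conj_mul, ← zpow_add, ← zpow_add, add_comm]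

theorem powerIndexBound_ker : PowerIndexBound (height n).ker 1 := by
  classical
  intro d hd F hF hcard
  have : NeZero d := ⟨hd.ne'⟩
  have h : ∀ a, ∃ I : ℕ, a ∈ F → ∀ i, I ≤ i → ∃ e : ℤ,
      a = y n ^ i * x n ^ e * (y n ^ i)⁻¹ := by
    intro a
    by_cases ha : a ∈ F
    · obtain ⟨I, hI⟩ := exists_forall_ge_of_mem n (hF ha)
      exact ⟨I, fun _ => hI⟩
    · exact ⟨0, fun h => absurd h ha⟩
  choose I hI using h
  have h : ∀ a, ∃ e : ℤ, a ∈ F → a = y n ^ F.sup I * x n ^ e * (y n ^ F.sup I)⁻¹ := by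
    intro a
    by_cases ha : a ∈ F
    · obtain ⟨e, he⟩ := hI a ha _ (Finset.le_sup ha)
      exact ⟨e, fun _ => he⟩
    · exact ⟨0, fun h => absurd h ha⟩
  choose e he using h
  obtain ⟨a, ha, b, hb, hab, hd⟩ := Finset.exists_ne_map_eq_of_card_lt_of_maps_to
    (s := F) (t := (Finset.univ : Finset (ZMod d))) (by simpa [ZMod.card] using hcard)
    (f := fun a => (e a : ZMod d)) (by simp [Set.MapsTo])
  obtain ⟨c, hc⟩ := (ZMod.intCast_eq_intCast_iff_dvd_sub _ _ _).1 hd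
  refine ⟨a, ha, b, hb, hab, _, y_pow_mul_mem n (F.sup I) c, ?_⟩
  rw [conj_pow, ← zpow_natCast (x n ^ c), ← zpow_mul, mul_comm c, ← hc]
  conv_lhs => rw [he a ha, he b hb]
  rw [conj_inv, conj_mul, ← zpow_neg (x n), ← zpow_add, neg_add_eq_sub]

theorem inv_pow_mul_mul (k : ℕ) {a : BaumslagSolitar n} (ha : a ∈ (height n).ker) :
    (y n)⁻¹ ^ k * a * ((y n)⁻¹ ^ k)⁻¹ = a ^ (n ^ k) := by
  obtain ⟨I, hI⟩ := exists_forall_ge_of_mem n ha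
  obtain ⟨e, rfl⟩ := hI I le_rfl
  rw [conj_zpow, ← zpow_mul, mul_comm e, ← inv_pow_mul_x_zpow_mul]
  group

/-- The affine action on a commutative ring in which `n` is a unit: `x` acts as `w ↦ w + 1` and `y`
as `w ↦ n⁻¹ w`. -/
def affine {R : Type*} [CommRing R] (ν : Rˣ) (hν : (ν : R) = n) :
    BaumslagSolitar n →* Equiv.Perm R :=
  lift n (Equiv.addRight 1) (Units.mulRight ν⁻¹) (by
    have h : ∀ e : ℤ, (Equiv.addRight (1 : R)) ^ e = Equiv.addRight (e : R) := by
      intro e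
      induction e using Int.induction_on with
      | zero => ext; simp
      | succ i ih => rw [zpow_add_one, ih]; ext w; simp; ring
      | pred i ih => rw [zpow_sub_one, ih]; ext w; simp; ring
    rw [h]
    ext w
    simp [Equiv.Perm.inv_def, add_mul, ← hν])

section affine

variable {R : Type*} [CommRing R] (ν : Rˣ) (hν : (ν : R) = n)

theorem affine_x_zpow (e : ℤ) (w : R) : affine n ν hν (x n ^ e) w = w + e := by
  have h : ∀ w, affine n ν hν (x n) w = w + 1 := fun w => by simp [affine]
  have h' : ∀ w, (affine n ν hν (x n))⁻¹ w = w - 1 := fun w => by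
    rw [Equiv.Perm.inv_eq_iff_eq, h, sub_add_cancel]
  rw [map_zpow]
  induction e using Int.induction_on generalizing w with
  | zero => simp
  | succ i ih => rw [zpow_add_one, Equiv.Perm.mul_apply, ih, h]; push_cast; ring
  | pred i ih => rw [zpow_sub_one, Equiv.Perm.mul_apply, ih, h']; push_cast; ring

theorem affine_y (w : R) : affine n ν hν (y n) w = w * (ν⁻¹ : Rˣ) := by
  simp [affine]

theorem affine_apply_of_mem {a : BaumslagSolitar n} (ha : a ∈ (height n).ker) (w : R) :
    affine n ν hν a w = w + affine n ν hν a 0 := by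
  have hy : ∀ (i : ℕ) (v w : R), affine n ν hν (y n ^ i) (v + w) =
      affine n ν hν (y n ^ i) v + affine n ν hν (y n ^ i) w := by
    intro i v w
    induction i with
    | zero => simp
    | succ i ih => rw [pow_succ', map_mul, Equiv.Perm.mul_apply, Equiv.Perm.mul_apply,
        Equiv.Perm.mul_apply, ih, affine_y, affine_y, affine_y, add_mul]
  have hy0 : ∀ i : ℕ, affine n ν hν (y n ^ i) 0 = 0 := fun i => by simpa using hy i 0 0
  obtain ⟨I, hI⟩ := exists_forall_ge_of_mem n ha
  obtain ⟨e, rfl⟩ := hI I le_rfl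
  have hinv : (affine n ν hν (y n ^ I))⁻¹ 0 = 0 := by rw [Equiv.Perm.inv_eq_iff_eq, hy0]
  have hcancel : ∀ w, affine n ν hν (y n ^ I) ((affine n ν hν (y n ^ I))⁻¹ w) = w := fun w => by
    rw [← Equiv.Perm.mul_apply, mul_inv_cancel, Equiv.Perm.one_apply]
  simp only [map_mul, map_inv, Equiv.Perm.mul_apply, hinv, affine_x_zpow, hy, hcancel, zero_add]

end affine

theorem fg : Group.FG (BaumslagSolitar n) :=
  Group.fg_of_surjective (f := PresentedGroup.mk _) (PresentedGroup.mk_surjective _)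

theorem residuallyFinite (hn : n ≠ 0) : Group.ResiduallyFinite (BaumslagSolitar n) := by
  rw [Group.residuallyFinite_iff_exists_finiteIndex]
  intro g hg
  by_cases hr : height n g = 1
  · obtain ⟨I, hI⟩ := exists_forall_ge_of_mem n (MonoidHom.mem_ker.2 hr)
    obtain ⟨e, rfl⟩ := hI I le_rfl
    have he : e ≠ 0 := by
      rintro rfl
      simp at hg
    -- This modulus is prime to `n`, so the affine action exists over `ZMod d`, and it exceeds
    -- `|e|`, so `x ^ e` acts nontrivially.
    let d : ℕ := (n * e).natAbs + 1
    have hunit : IsUnit (n : ZMod d) := by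
      have hd : (((n * e).natAbs + 1 : ℕ) : ZMod d) = 0 := ZMod.natCast_self d
      refine IsUnit.of_mul_eq_one (-(n * e).sign * e : ℤ) ?_
      have h : ((n * (-(n * e).sign * e) : ℤ) : ZMod d) = 1 := by
        have h1 : n * (-(n * e).sign * e) = -((n * e).natAbs : ℤ) := by
          rw [← Int.abs_eq_natAbs, ← Int.sign_mul_self_eq_abs]
          ring
        rw [Nat.cast_add, Nat.cast_one] at hd
        rw [h1, Int.cast_neg, Int.cast_natCast]
        linear_combination -hd
      exact_mod_cast h
    obtain ⟨ν, hν⟩ := hunit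
    have : NeZero d := ⟨Nat.succ_ne_zero _⟩
    refine ⟨(affine n ν hν).ker, Subgroup.finiteIndex_ker _, fun h => ?_⟩
    rw [MonoidHom.mem_ker, map_mul, map_mul, map_inv, conj_eq_one_iff] at h
    have h0 := affine_x_zpow n ν hν e 0
    rw [h, Equiv.Perm.one_apply, zero_add, eq_comm, ZMod.intCast_zmod_eq_zero_iff_dvd,
      Int.natCast_dvd] at h0
    have h1 := Nat.le_of_dvd (Int.natAbs_pos.2 he) h0
    have h2 : e.natAbs ≤ (n * e).natAbs := by
      rw [Int.natAbs_mul]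
      exact Nat.le_mul_of_pos_left _ (Int.natAbs_pos.2 hn)
    omega
  · exact exists_finiteIndex_notMem_of_hom_int _ hr

theorem growthLE_RF (hn : 1 < |n|) (S : Finset (BaumslagSolitar n))
    (hS : Subgroup.closure (S : Set (BaumslagSolitar n)) = ⊤) :
    GrowthLE (fun r => r * Real.log r) (fun r => (RF S r : ℝ)) := by
  have hn0 : n ≠ 0 := by
    rintro rfl
    norm_num at hn
  have hnC : (n : ℂ) ≠ 0 := by exact_mod_cast hn0
  have hnorm : 1 < ‖(n : ℂ)‖ := by
    rw [Complex.norm_intCast]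
    exact_mod_cast hn
  -- Over `ℂ` the kernel acts by translations; the translation `ρ g 0` is the additive coordinate,
  -- and conjugation by `y` divides it by `n`.
  let ρ := affine n (Units.mk0 (n : ℂ) hnC) rfl
  have hρy : ∀ w, ρ (y n) w = w * (n : ℂ)⁻¹ := fun w => affine_y n (Units.mk0 (n : ℂ) hnC) rfl w
  have htrans : ∀ a ∈ (height n).ker, ∀ w, ρ a w = w + ρ a 0 :=
    fun a ha w => affine_apply_of_mem n _ _ ha w
  refine _root_.growthLE_RF (residuallyFinite n hn0) (ker_comm n) (powerIndexBound_ker n)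
    (t := (y n)⁻¹) (B := 2 * n.natAbs) ?_ (a := x n) (u := y n) (by simp [MonoidHom.mem_ker])
    (f := fun g => ρ g 0) ?_ (inv_ne_zero hnC)
    (by rw [norm_inv]; exact inv_lt_one_of_one_lt₀ hnorm) ?_ ?_ S hS
  · intro k hk
    have habs : 1 < |n ^ k| := by
      rw [abs_pow]
      exact one_lt_pow₀ hn hk.ne'
    refine ⟨(n ^ k - 1).natAbs, Int.natAbs_pos.2 fun h => ?_, ?_, fun N _ hN a ha => ?_⟩
    · rw [sub_eq_zero.1 h] at habs
      norm_num at habs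
    · have h2 : 2 ≤ 2 ^ k := Nat.le_self_pow hk.ne' 2
      have h1 : (n ^ k - 1).natAbs ≤ (n ^ k).natAbs + 1 := Int.natAbs_sub_le _ _
      have h3 : 0 < n.natAbs ^ k := Nat.pow_pos (Int.natAbs_pos.2 hn0)
      rw [Int.natAbs_pow] at h1
      -- This is where `B = 2|n|` comes from: `|n ^ k - 1| ≤ |n| ^ k + 1 ≤ (2|n|) ^ k`.
      calc _ ≤ 2 * n.natAbs ^ k := by omega
        _ ≤ 2 ^ k * n.natAbs ^ k := Nat.mul_le_mul_right _ h2
        _ = _ := by rw [mul_pow]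
    · have h := hN a ha
      rw [inv_pow_mul_mul n k ha, ← zpow_sub_one] at h
      rw [← zpow_natCast]
      rcases Int.natAbs_eq (n ^ k - 1) with h3 | h3
      · rwa [← h3]
      · rwa [h3, zpow_neg, inv_mem_iff] at h
  · intro a ha b hb
    simp only [map_mul, Equiv.Perm.mul_apply]
    rw [htrans a ha (ρ b 0), add_comm]
  · intro a ha
    have hinv : ρ (y n)⁻¹ 0 = 0 := by
      rw [map_inv, Equiv.Perm.inv_eq_iff_eq, hρy, zero_mul]
    simp only [map_mul, Equiv.Perm.mul_apply, hinv, hρy, mul_comm]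
  · have := affine_x_zpow n (Units.mk0 (n : ℂ) hnC) rfl 1 0
    rw [zpow_one] at this
    simp [ρ, this]

end BaumslagSolitar

theorem mainTheorem6 :
    (∀ (m : ℕ) (_hm : 0 < m) (M : GL (Fin m) ℤ)
      (_hM : ∀ μ : ℂ, IsComplexEigenvalue (M : Matrix (Fin m) (Fin m) ℤ) μ →
        ∀ k : ℕ, 0 < k → μ ^ k ≠ 1),
      Group.FG (MatrixSemidirect M) ∧ Group.ResiduallyFinite (MatrixSemidirect M) ∧
      ∀ S : Finset (MatrixSemidirect M), Subgroup.closure (S : Set (MatrixSemidirect M)) = ⊤ →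
        GrowthLE (fun r => r * Real.log r) (fun r => (RF S r : ℝ))) ∧
    (∀ (n : ℤ) (_hn : 1 < |n|),
      Group.FG (BaumslagSolitar n) ∧ Group.ResiduallyFinite (BaumslagSolitar n) ∧
      ∀ S : Finset (BaumslagSolitar n), Subgroup.closure (S : Set (BaumslagSolitar n)) = ⊤ →
        GrowthLE (fun r => r * Real.log r) (fun r => (RF S r : ℝ))) := by
  refine ⟨fun m hm M hM => ?_, fun n hn => ?_⟩
  · exact ⟨MatrixSemidirect.fg M, MatrixSemidirect.residuallyFinite M,
      MatrixSemidirect.growthLE_RF M hm hM⟩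
  · have hn0 : n ≠ 0 := by
      rintro rfl
      norm_num at hn
    exact ⟨BaumslagSolitar.fg n, BaumslagSolitar.residuallyFinite n hn0,
      BaumslagSolitar.growthLE_RF n hn⟩
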